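/- Throughout, $\sigma>0$ is fixed, $\sigma_d^2=\sigma^2/d$, $\lambda=\lambda_d=(d-2)\sigma_d^2$, and $S_\lambda(x)=x\,(1-\lambda/\|x\|^2)$ is the James–Stein estimator on $\mathbb{R}^d$, where $\|\cdot\|=\|\cdot\|_2$. For positive constants $C_4,C_{-2}$ and $\theta\in\mathbb{R}^d$ let $\mathcal{P}_d(\theta,C_4,C_{-2})$ be the set of laws of $X=Y+\theta$, where the law of $Y$ is a mixture $\int_{\mathcal S} m_s\,\mu(ds)$, with $\mu$ a probability measure on a measurable space $\mathcal S$ and $(m_s)_{s\in\mathcal S}$ a measurable family of probability measures on $\mathbb{R}^d$, such that for every $s$ a vector $Y_s\sim m_s$ has mean zero, covariance matrix $\sigma_d^2\,\mathrm{Id}$, independent coordinates, $\max_i E[Y_{s,i}^4]\le C_4$, and $\max_i E\big[(d/\|X_s^{\neg i}\|^2)^2\big]\le C_{-2}$, where $X_s=Y_s+\theta$ and $x^{\neg i}$ denotes $x$ with the $i$-th coordinate removed. **Theorem 4.6.** (1) There is a constant $L>0$, depending only on $\sigma^2$, $C_4$ and $C_{-2}$, such that for all $d\ge 3$, all $\theta\in\mathbb{R}^d$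 and all $X$ whose law belongs to $\mathcal{P}_d(\theta,C_4,C_{-2})$, $$E\big[\|S_\lambda(X)-\theta\|^2\big]\le \frac{\sigma^2\|\theta\|^2}{\sigma^2+\|\theta\|^2}\Big(1+\frac{4\sigma^2}{d\|\theta\|^2}\Big)+L\lambda\Big(\frac1d+\frac{\|\theta\|_1}{d^2}+\frac{\|\theta\|_2^2}{d^3}\Big),$$ where the first term is read as $\frac{\sigma^2}{\sigma^2+\|\theta\|^2}\big(\|\theta\|^2+\frac{4\sigma^2}{d}\big)$ (this matters only for $\theta=0$). (2) (Asymptotic adaptivity.) Let $C_4,C_{-2}$ be positive constants, now bounding the moments of the standardized vectors: for $c>0$ let $\mathcal{P}_d(c)$ be the set of all laws $P\in\mathcal{P}_d(\theta,\,C_4/d^2,\,d^2C_{-2})$ with $\|\theta\|\le c$, that is, of those for which $E[(\sqrt d\,Y_{s,i})^4]\le C_4$ and $E\big[(d/\|\sqrt d\,X_s^{\neg i}\|^2)^2\big]\le C_{-2}$ for all $s$ and $i$. Then for every $c>0$ for which, for all large $d$, $\mathcal{N}(\theta,\sigma_d^2\,\mathrm{Id})\in\mathcal{P}_d(\theta,C_4/d^2,d^2C_{-2})$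 for all $\|\theta\|\le c$, the James–Stein estimator $S_\lambda$, which does not depend on $c$, attains asymptotically the minimax risk over $\mathcal{P}_d(c)$, and the latter equals Pinsker's: $$\lim_{d\to\infty}\ \sup_{P\in\mathcal{P}_d(c)}E_P\|S_\lambda(X)-\theta\|^2=\lim_{d\to\infty}\ \inf_{\widehat\theta}\ \sup_{P\in\mathcal{P}_d(c)}E_P\|\widehat\theta(X)-\theta\|^2=\frac{\sigma^2c^2}{\sigma^2+c^2},$$ where $\theta$ is the mean of $P$ and the infimum is over all measurable $\widehat\theta:\mathbb{R}^d\to\mathbb{R}^d$. -/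

import Mathlib

open MeasureTheory ProbabilityTheory Filter Topology
open scoped ENNReal

namespace JamesSteinZeroBias

/-- The law `m` of a component `Y_s` of the mixture: it is centred, has covariance matrix `v • Id`,
independent coordinates and fourth moments `E[Y_{s,i}^4] ≤ C₄`, and the translate
`X_s = Y_s + θ` satisfies the negative moment condition
`max_i E[(d / ‖X_s^{¬i}‖²)²] ≤ Cneg`, where `x^{¬i}` is `x` with its `i`-th coordinate deleted.
The last two expectations are taken in `[0, ∞]`, with `d / 0 = ∞`. -/
structure IsComponentLaw (d : ℕ) (v : ℝ) (θ : EuclideanSpace ℝ (Fin d)) (C₄ Cneg : ℝ)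
    (m : Measure (EuclideanSpace ℝ (Fin d))) : Prop where
  isProbabilityMeasure : IsProbabilityMeasure m
  memLp_two : ∀ i, MemLp (fun y : EuclideanSpace ℝ (Fin d) => y i) 2 m
  mean_zero : ∀ i, ∫ y : EuclideanSpace ℝ (Fin d), y i ∂m = 0
  covariance_eq : ∀ i j,
    covariance (fun y : EuclideanSpace ℝ (Fin d) => y i) (fun y => y j) m = if i = j then v else 0
  indep : iIndepFun (fun (i : Fin d) (y : EuclideanSpace ℝ (Fin d)) => y i) m
  fourth_moment : ∀ i,
    ∫⁻ y : EuclideanSpace ℝ (Fin d), ENNReal.ofReal (y i ^ 4) ∂m ≤ ENNReal.ofReal C₄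
  inverse_moment : ∀ i,
    ∫⁻ y : EuclideanSpace ℝ (Fin d),
      ((d : ℝ≥0∞) / ENNReal.ofReal (∑ j ∈ Finset.univ.erase i, (y j + θ j) ^ 2)) ^ 2 ∂m
      ≤ ENNReal.ofReal Cneg

/-- The class `𝒫(θ, C₄, Cneg)` in dimension `d` with coordinate variance `v`: the laws of
`X = Y + θ`, where the law of `Y` is the `μ`-mixture of a measurable family `(m s)` of component
laws. Index spaces `S : Type` suffice, as a mixture only depends on the law of `m s` under `μ`. -/
def mixtureClass (d : ℕ) (v : ℝ) (C₄ Cneg : ℝ) (θ : EuclideanSpace ℝ (Fin d)) :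
    Set (Measure (EuclideanSpace ℝ (Fin d))) :=
  {P | ∃ (S : Type) (_ : MeasurableSpace S) (μ : Measure S)
      (m : Kernel S (EuclideanSpace ℝ (Fin d))),
      IsProbabilityMeasure μ ∧ (∀ s, IsComponentLaw d v θ C₄ Cneg (m s)) ∧
      P = (μ.bind m).map (fun y => y + θ)}

/-- The shrinkage estimator `S_λ(x) = x (1 - λ / ‖x‖²)`. -/
noncomputable def shrinkage {d : ℕ} (lam : ℝ) (x : EuclideanSpace ℝ (Fin d)) :
    EuclideanSpace ℝ (Fin d) :=
  (1 - lam / ‖x‖ ^ 2) • x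

/-- The quadratic risk `E_P ‖T(X) - θ‖²`, as an element of `[0, ∞]`. -/
noncomputable def risk {d : ℕ} (P : Measure (EuclideanSpace ℝ (Fin d)))
    (θ : EuclideanSpace ℝ (Fin d)) (T : EuclideanSpace ℝ (Fin d) → EuclideanSpace ℝ (Fin d)) :
    ℝ≥0∞ :=
  ∫⁻ x, ENNReal.ofReal (‖T x - θ‖ ^ 2) ∂P

/-- The maximal risk of the estimator `T` over all `P ∈ Q θ` with `‖θ‖ ≤ c`. -/
noncomputable def maxRisk {d : ℕ}
    (Q : EuclideanSpace ℝ (Fin d) → Set (Measure (EuclideanSpace ℝ (Fin d)))) (c : ℝ)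
    (T : EuclideanSpace ℝ (Fin d) → EuclideanSpace ℝ (Fin d)) : ℝ≥0∞ :=
  ⨆ (θ : EuclideanSpace ℝ (Fin d)) (_ : ‖θ‖ ≤ c)
    (P : Measure (EuclideanSpace ℝ (Fin d))) (_ : P ∈ Q θ), risk P θ T

/-- The minimax risk over all `P ∈ Q θ` with `‖θ‖ ≤ c`: the infimum, over all estimators
(measurable functions of the observation), of the maximal risk. -/
noncomputable def minimaxRisk {d : ℕ}
    (Q : EuclideanSpace ℝ (Fin d) → Set (Measure (EuclideanSpace ℝ (Fin d)))) (c : ℝ) : ℝ≥0∞ :=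
  ⨅ (T : EuclideanSpace ℝ (Fin d) → EuclideanSpace ℝ (Fin d)) (_ : Measurable T), maxRisk Q c T

end JamesSteinZeroBias

/-! Upper bound. Write `v` for the coordinate variance, so that λ = (d-2)v. Expanding the square,
the loss is ‖Y‖² - 2λ⟨Y, X⟩/‖X‖² + λ²/‖X‖². If Stein's identity E[Y_i f(X)] = v E[∂_i f(X)] held for
f(x) = x_i/‖x‖², the divergence (d-2)/‖x‖² of x/‖x‖² would reduce the risk to dv - λ² E[1/‖X‖²], and
Jensen's inequality would finish. For non-Gaussian coordinates the identity holds up to an error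
(`abs_integral_mul_div_sub_le`): Y_i is independent of R = ‖X^{¬i}‖², so x/(R+x²) can be expanded
around θ_i. The terms of order one and two cancel against E[Y_i] = 0 and E[Y_i²] = v, and the
remainder is a polynomial in Y_i times R⁻², controlled by the fourth and inverse moments. The risk
is linear in the law, so mixtures cost nothing.

Lower bound. Only the Gaussian laws are needed. Under the prior N(0, (b²/d) Id) with b < c the Bayes
risk is at least σ²b²/(σ²+b²), by rotation invariance of a pair of Gaussian vectors
(`le_bayesRisk_stdGaussian`). The prior leaves the ball of radius c only when ‖θ‖² deviates from its
mean b², and a second moment bound makes the contribution of this event O(1/d) (`bayesRisk_le_add`).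
Letting d → ∞ and then b ↑ c matches the upper bound. -/

namespace JamesSteinZeroBias

/-! ### Taylor remainders and the approximate Stein identity -/

/-- Second-order remainder of `x ↦ x / (R + x²)`. -/
lemma abs_div_add_sq_sub_le {R t y : ℝ} (hR : 0 < R) :
    |(y + t) / (R + (y + t) ^ 2) - t / (R + t ^ 2) - y * ((R - t ^ 2) / (R + t ^ 2) ^ 2)|
      ≤ y ^ 2 * (|y| + 3 * |t|) / R ^ 2 := by
  have hA : 0 < R + (y + t) ^ 2 := by positivity
  have hB : 0 < R + t ^ 2 := by positivity
  -- The remainder is exactly y² times a rational function, so no bound on second derivatives is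
  -- needed.
  have key : (y + t) / (R + (y + t) ^ 2) - t / (R + t ^ 2) - y * ((R - t ^ 2) / (R + t ^ 2) ^ 2)
      = y ^ 2 * ((t ^ 2 * (y + t) - R * (y + t + 2 * t))
        / ((R + (y + t) ^ 2) * (R + t ^ 2) ^ 2)) := by
    field_simp
    ring
  have h1 : |t ^ 2 * (y + t) - R * (y + t + 2 * t)| ≤ (R + t ^ 2) * (|y| + 3 * |t|) := by
    have hx : |y + t| ≤ |y| + |t| := abs_add_le y t
    calc |t ^ 2 * (y + t) - R * (y + t + 2 * t)|
        ≤ |t ^ 2 * (y + t)| + |R * (y + t + 2 * t)| := abs_sub _ _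
      _ = t ^ 2 * |y + t| + R * |y + t + 2 * t| := by
          rw [abs_mul, abs_mul, abs_of_pos hR, abs_of_nonneg (sq_nonneg t)]
      _ ≤ t ^ 2 * (|y| + 3 * |t|) + R * (|y| + 3 * |t|) := by
          gcongr
          · linarith [abs_nonneg t]
          · calc |y + t + 2 * t| = |y + 3 * t| := by ring_nf
              _ ≤ |y| + |3 * t| := abs_add_le _ _
              _ = |y| + 3 * |t| := by rw [abs_mul]; norm_num
      _ = _ := by ring
  rw [key, abs_mul, abs_of_nonneg (sq_nonneg y), abs_div, mul_div_assoc,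
    abs_of_pos (by positivity : 0 < (R + (y + t) ^ 2) * (R + t ^ 2) ^ 2)]
  refine mul_le_mul_of_nonneg_left ?_ (sq_nonneg y)
  calc |t ^ 2 * (y + t) - R * (y + t + 2 * t)| / ((R + (y + t) ^ 2) * (R + t ^ 2) ^ 2)
      ≤ (R + t ^ 2) * (|y| + 3 * |t|) / ((R + (y + t) ^ 2) * (R + t ^ 2) ^ 2) := by gcongr
    _ = (|y| + 3 * |t|) / ((R + (y + t) ^ 2) * (R + t ^ 2)) := by field_simp
    _ ≤ (|y| + 3 * |t|) / (R * R) := by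
        gcongr
        · nlinarith [sq_nonneg (y + t)]
        · nlinarith [sq_nonneg t]
    _ = (|y| + 3 * |t|) / R ^ 2 := by rw [sq R]

/-- First-order remainder of the derivative of `x ↦ x / (R + x²)`. -/
lemma abs_deriv_div_add_sq_sub_le {R t y : ℝ} (hR : 0 < R) :
    |(R - (y + t) ^ 2) / (R + (y + t) ^ 2) ^ 2 - (R - t ^ 2) / (R + t ^ 2) ^ 2|
      ≤ 5 * (|y| * (|y| + 2 * |t|)) / R ^ 2 := by
  set A := R + (y + t) ^ 2 with hAdef
  set B := R + t ^ 2 with hBdef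
  have hA : R ≤ A := by nlinarith [sq_nonneg (y + t)]
  have hB : R ≤ B := by nlinarith [sq_nonneg t]
  have hA0 : 0 < A := hR.trans_le hA
  have hB0 : 0 < B := hR.trans_le hB
  -- The derivative is 2R/A² - 1/A, so the difference has the factor 1/A - 1/B.
  have key : (R - (y + t) ^ 2) / A ^ 2 - (R - t ^ 2) / B ^ 2
      = (-(y * (y + 2 * t)) / (A * B)) * (2 * (R / A) + 2 * (R / B) - 1) := by
    rw [show R - (y + t) ^ 2 = 2 * R - A by rw [hAdef]; ring,
      show R - t ^ 2 = 2 * R - B by rw [hBdef]; ring,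
      show -(y * (y + 2 * t)) = B - A by rw [hAdef, hBdef]; ring]
    field_simp
    ring
  have h1 : |2 * (R / A) + 2 * (R / B) - 1| ≤ 5 := by
    have a1 : R / A ≤ 1 := (div_le_one hA0).2 hA
    have a2 : R / B ≤ 1 := (div_le_one hB0).2 hB
    have a3 : 0 ≤ R / A := by positivity
    have a4 : 0 ≤ R / B := by positivity
    rw [abs_le]
    constructor <;> linarith
  have h2 : |(-(y * (y + 2 * t)) / (A * B))| ≤ |y| * (|y| + 2 * |t|) / R ^ 2 := by
    rw [abs_div, abs_neg, abs_mul, abs_of_pos (mul_pos hA0 hB0), sq]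
    gcongr
    calc |y + 2 * t| ≤ |y| + |2 * t| := abs_add_le _ _
      _ = |y| + 2 * |t| := by rw [abs_mul]; norm_num
  rw [key, abs_mul]
  calc _ ≤ |y| * (|y| + 2 * |t|) / R ^ 2 * 5 := by gcongr
    _ = _ := by ring

/-- AM-GM at a free scale `s` trades the odd powers |y| and |y|³ for even ones, leaving only second
and fourth moments. The best `s` is of the order of y. -/
lemma remainder_poly_le {t y v s : ℝ} (hv : 0 ≤ v) (hs : 0 < s) :
    |y| * (y ^ 2 * (|y| + 3 * |t|)) + v * (5 * (|y| * (|y| + 2 * |t|))) ≤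
      y ^ 4 + 5 * v * y ^ 2
        + |t| * (3 / 2 * (s * y ^ 2 + y ^ 4 / s) + 5 * v * (s + y ^ 2 / s)) := by
  have h1 : 2 * |y| ≤ s + y ^ 2 / s := by
    have : s + y ^ 2 / s - 2 * |y| = (s - |y|) ^ 2 / s := by
      rw [← sq_abs y]; field_simp; ring
    have h : 0 ≤ (s - |y|) ^ 2 / s := by positivity
    linarith
  have h2 : 2 * (|y| * y ^ 2) ≤ s * y ^ 2 + y ^ 4 / s := by
    calc 2 * (|y| * y ^ 2) = 2 * |y| * y ^ 2 := by ring
      _ ≤ (s + y ^ 2 / s) * y ^ 2 := by gcongr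
      _ = _ := by ring
  have h3 : |y| * |y| = y ^ 2 := by rw [← sq, sq_abs]
  calc _ = (|y| * |y|) * y ^ 2 + 5 * v * (|y| * |y|)
        + |t| * (3 / 2 * (2 * (|y| * y ^ 2)) + 5 * v * (2 * |y|)) := by ring
    _ ≤ y ^ 2 * y ^ 2 + 5 * v * y ^ 2
        + |t| * (3 / 2 * (s * y ^ 2 + y ^ 4 / s) + 5 * v * (s + y ^ 2 / s)) := by
        rw [h3]; gcongr
    _ = _ := by ring

/-- An approximate Stein identity for `x ↦ x / (R + x²)` and a centred variable `y` independent
of `R`. -/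
lemma abs_integral_mul_div_sub_le {Ω : Type*} [MeasurableSpace Ω] {μ : Measure Ω}
    [IsProbabilityMeasure μ] {y R : Ω → ℝ} (hy : Measurable y) (hR : Measurable R)
    (hRpos : ∀ᵐ ω ∂μ, 0 < R ω) (hRint : Integrable (fun ω => 1 / R ω ^ 2) μ)
    (hind : IndepFun y R μ) (hy2 : MemLp y 2 μ) (hy4 : Integrable (fun ω => y ω ^ 4) μ)
    {v C K : ℝ} (hmean : ∫ ω, y ω ∂μ = 0) (hvar : ∫ ω, y ω ^ 2 ∂μ = v)
    (hC : ∫ ω, y ω ^ 4 ∂μ ≤ C) (hK : ∫ ω, 1 / R ω ^ 2 ∂μ ≤ K) (t : ℝ) {s : ℝ} (hs : 0 < s) :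
    Integrable (fun ω => y ω * ((y ω + t) / (R ω + (y ω + t) ^ 2))) μ ∧
    Integrable (fun ω => (R ω - (y ω + t) ^ 2) / (R ω + (y ω + t) ^ 2) ^ 2) μ ∧
    |∫ ω, y ω * ((y ω + t) / (R ω + (y ω + t) ^ 2)) ∂μ
        - v * ∫ ω, (R ω - (y ω + t) ^ 2) / (R ω + (y ω + t) ^ 2) ^ 2 ∂μ|
      ≤ (C + 5 * v ^ 2 + |t| * (3 / 2 * (s * v + C / s) + 5 * v * (s + v / s))) * K := by
  have hv : 0 ≤ v := hvar ▸ integral_nonneg fun ω => sq_nonneg _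
  have iy : Integrable y μ := hy2.integrable (by norm_num)
  have iy2 : Integrable (fun ω => y ω ^ 2) μ := hy2.integrable_sq
  have iB : Integrable (fun ω => 1 + 1 / R ω ^ 2) μ := (integrable_const _).add hRint
  have hinv : ∀ r : ℝ, 0 < r → 1 / r ≤ 1 + 1 / r ^ 2 := fun r hr => by
    have : 1 + 1 / r ^ 2 - 1 / r = (1 / r - 1 / 2) ^ 2 + 3 / 4 := by field_simp; ring
    nlinarith [sq_nonneg (1 / r - 1 / 2)]
  have hderiv : ∀ r x : ℝ, 0 < r → |(r - x ^ 2) / (r + x ^ 2) ^ 2| ≤ 1 + 1 / r ^ 2 := by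
    intro r x hr
    have h0 : 0 < r + x ^ 2 := by positivity
    refine le_trans ?_ (hinv r hr)
    rw [abs_div, abs_of_pos (by positivity : 0 < (r + x ^ 2) ^ 2)]
    calc |r - x ^ 2| / (r + x ^ 2) ^ 2 ≤ (r + x ^ 2) / (r + x ^ 2) ^ 2 := by
          gcongr
          rw [abs_le]; constructor <;> nlinarith [sq_nonneg x]
      _ = 1 / (r + x ^ 2) := by field_simp
      _ ≤ 1 / r := by gcongr; nlinarith [sq_nonneg x]
  have i1 : Integrable (fun ω => y ω * ((y ω + t) / (R ω + (y ω + t) ^ 2))) μ := by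
    refine (iy2.add iB).mono' (Measurable.aestronglyMeasurable (by fun_prop)) ?_
    filter_upwards [hRpos] with ω hω
    set x := y ω + t
    have h0 : 0 < R ω + x ^ 2 := by positivity
    have h1 : (x / (R ω + x ^ 2)) ^ 2 ≤ 1 + 1 / R ω ^ 2 := by
      refine le_trans ?_ (hinv _ hω)
      calc (x / (R ω + x ^ 2)) ^ 2 = x ^ 2 / (R ω + x ^ 2) ^ 2 := by rw [div_pow]
        _ ≤ (R ω + x ^ 2) / (R ω + x ^ 2) ^ 2 := by gcongr; linarith
        _ = 1 / (R ω + x ^ 2) := by field_simp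
        _ ≤ 1 / R ω := by gcongr; nlinarith [sq_nonneg x]
    rw [Real.norm_eq_abs, Pi.add_apply, abs_le]
    constructor <;> nlinarith [sq_nonneg (y ω + x / (R ω + x ^ 2)),
      sq_nonneg (y ω - x / (R ω + x ^ 2)), sq_nonneg (y ω)]
  have i2 : Integrable (fun ω => (R ω - (y ω + t) ^ 2) / (R ω + (y ω + t) ^ 2) ^ 2) μ := by
    refine iB.mono' (Measurable.aestronglyMeasurable (by fun_prop)) ?_
    filter_upwards [hRpos] with ω hω
    exact hderiv _ _ hω
  have i3 : Integrable (fun ω => t / (R ω + t ^ 2)) μ := by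
    refine (iB.const_mul |t|).mono' (Measurable.aestronglyMeasurable (by fun_prop)) ?_
    filter_upwards [hRpos] with ω hω
    have h0 : 0 < R ω + t ^ 2 := by positivity
    rw [Real.norm_eq_abs, abs_div, abs_of_pos h0, div_eq_mul_one_div]
    gcongr
    refine le_trans ?_ (hinv _ hω)
    gcongr
    nlinarith [sq_nonneg t]
  have i4 : Integrable (fun ω => (R ω - t ^ 2) / (R ω + t ^ 2) ^ 2) μ := by
    refine iB.mono' (Measurable.aestronglyMeasurable (by fun_prop)) ?_
    filter_upwards [hRpos] with ω hω
    exact hderiv _ _ hω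
  have ind1 : IndepFun y (fun ω => t / (R ω + t ^ 2)) μ :=
    hind.comp (φ := id) (ψ := fun r => t / (r + t ^ 2)) measurable_id (by fun_prop)
  have ind2 : IndepFun (fun ω => y ω ^ 2 - v) (fun ω => (R ω - t ^ 2) / (R ω + t ^ 2) ^ 2) μ :=
    hind.comp (φ := fun y => y ^ 2 - v) (ψ := fun r => (r - t ^ 2) / (r + t ^ 2) ^ 2)
      (by fun_prop) (by fun_prop)
  have iy2v : Integrable (fun ω => y ω ^ 2 - v) μ := iy2.sub (integrable_const _)
  have j1 : Integrable (fun ω => y ω * (t / (R ω + t ^ 2))) μ := ind1.integrable_mul iy i3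
  have j2 : Integrable (fun ω => (y ω ^ 2 - v) * ((R ω - t ^ 2) / (R ω + t ^ 2) ^ 2)) μ :=
    ind2.integrable_mul iy2v i4
  have z1 : ∫ ω, y ω * (t / (R ω + t ^ 2)) ∂μ = 0 := by
    rw [ind1.integral_fun_mul_eq_mul_integral iy.1 i3.1, hmean, zero_mul]
  have z2 : ∫ ω, (y ω ^ 2 - v) * ((R ω - t ^ 2) / (R ω + t ^ 2) ^ 2) ∂μ = 0 := by
    rw [ind2.integral_fun_mul_eq_mul_integral iy2v.1 i4.1,
      integral_sub iy2 (integrable_const _), hvar]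
    simp
  -- `Q (y) / R²` will dominate the sum of both remainders.
  let Q : ℝ → ℝ := fun y => y ^ 4 + 5 * v * y ^ 2
        + |t| * (3 / 2 * (s * y ^ 2 + y ^ 4 / s) + 5 * v * (s + y ^ 2 / s))
  have iQ : Integrable (fun ω => Q (y ω)) μ :=
    (hy4.add (iy2.const_mul _)).add (((((iy2.const_mul _).add (hy4.div_const _)).const_mul _).add
      (((integrable_const _).add (iy2.div_const _)).const_mul _)).const_mul _)
  have hQ : ∫ ω, Q (y ω) ∂μ
      ≤ C + 5 * v ^ 2 + |t| * (3 / 2 * (s * v + C / s) + 5 * v * (s + v / s)) := by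
    have : ∫ ω, Q (y ω) ∂μ = ∫ ω, ((1 + |t| * (3 / 2 / s)) * y ω ^ 4
        + (5 * v + |t| * (3 / 2 * s + 5 * v / s)) * y ω ^ 2 + |t| * (5 * v * s)) ∂μ := by
      congr 1; ext ω; simp only [Q]; ring
    have k : Integrable (fun ω => (1 + |t| * (3 / 2 / s)) * y ω ^ 4
        + (5 * v + |t| * (3 / 2 * s + 5 * v / s)) * y ω ^ 2) μ :=
      (hy4.const_mul _).add (iy2.const_mul _)
    rw [this, integral_add k (integrable_const _), integral_add (hy4.const_mul _) (iy2.const_mul _),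
      integral_const_mul, integral_const_mul, hvar, integral_const, probReal_univ, one_smul]
    calc _ ≤ (1 + |t| * (3 / 2 / s)) * C + (5 * v + |t| * (3 / 2 * s + 5 * v / s)) * v
          + |t| * (5 * v * s) := by gcongr
      _ = _ := by ring
  have hQ0 : ∀ y, 0 ≤ Q y := fun y => by positivity
  have indQ : IndepFun (fun ω => Q (y ω)) (fun ω => 1 / R ω ^ 2) μ :=
    hind.comp (φ := Q) (ψ := fun r => 1 / r ^ 2) (by fun_prop) (by fun_prop)
  refine ⟨i1, i2, ?_⟩
  -- With f(x) = x/(R+x²), the mean-zero terms y f(t) and (y²-v) f'(t) are subtracted; what is left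
  -- under the integral is y times the remainder of f minus v times that of f'.
  have e : ∫ ω, y ω * ((y ω + t) / (R ω + (y ω + t) ^ 2)) ∂μ
        - v * ∫ ω, (R ω - (y ω + t) ^ 2) / (R ω + (y ω + t) ^ 2) ^ 2 ∂μ
      = ∫ ω, (y ω * ((y ω + t) / (R ω + (y ω + t) ^ 2))
          - v * ((R ω - (y ω + t) ^ 2) / (R ω + (y ω + t) ^ 2) ^ 2)
          - y ω * (t / (R ω + t ^ 2))
          - (y ω ^ 2 - v) * ((R ω - t ^ 2) / (R ω + t ^ 2) ^ 2)) ∂μ := by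
    have k1 : Integrable (fun ω => y ω * ((y ω + t) / (R ω + (y ω + t) ^ 2))
        - v * ((R ω - (y ω + t) ^ 2) / (R ω + (y ω + t) ^ 2) ^ 2)) μ := i1.sub (i2.const_mul v)
    have k2 : Integrable (fun ω => y ω * ((y ω + t) / (R ω + (y ω + t) ^ 2))
        - v * ((R ω - (y ω + t) ^ 2) / (R ω + (y ω + t) ^ 2) ^ 2)
        - y ω * (t / (R ω + t ^ 2))) μ := k1.sub j1
    rw [integral_sub k2 j2, z2, integral_sub k1 j1, z1, integral_sub i1 (i2.const_mul v),
      integral_const_mul]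
    ring
  rw [e]
  calc _ ≤ ∫ ω, Q (y ω) * (1 / R ω ^ 2) ∂μ := by
        have iQR : Integrable (fun ω => Q (y ω) * (1 / R ω ^ 2)) μ := indQ.integrable_mul iQ hRint
        rw [← Real.norm_eq_abs]
        refine norm_integral_le_of_norm_le iQR ?_
        filter_upwards [hRpos] with ω hω
        have a1 := abs_div_add_sq_sub_le (t := t) (y := y ω) hω
        have a2 := abs_deriv_div_add_sq_sub_le (t := t) (y := y ω) hω
        have a3 := remainder_poly_le (t := t) (y := y ω) hv hs
        set f1 := (y ω + t) / (R ω + (y ω + t) ^ 2)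
        set f0 := t / (R ω + t ^ 2)
        set g1 := (R ω - (y ω + t) ^ 2) / (R ω + (y ω + t) ^ 2) ^ 2
        set g0 := (R ω - t ^ 2) / (R ω + t ^ 2) ^ 2
        calc ‖y ω * f1 - v * g1 - y ω * f0 - (y ω ^ 2 - v) * g0‖
            = |y ω * (f1 - f0 - y ω * g0) - v * (g1 - g0)| := by
              rw [Real.norm_eq_abs]; congr 1; ring
          _ ≤ |y ω * (f1 - f0 - y ω * g0)| + |v * (g1 - g0)| := abs_sub _ _
          _ = |y ω| * |f1 - f0 - y ω * g0| + v * |g1 - g0| := by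
              rw [abs_mul, abs_mul, abs_of_nonneg hv]
          _ ≤ |y ω| * (y ω ^ 2 * (|y ω| + 3 * |t|) / R ω ^ 2)
              + v * (5 * (|y ω| * (|y ω| + 2 * |t|)) / R ω ^ 2) := by gcongr
          _ = (|y ω| * (y ω ^ 2 * (|y ω| + 3 * |t|))
              + v * (5 * (|y ω| * (|y ω| + 2 * |t|)))) * (1 / R ω ^ 2) := by ring
          _ ≤ Q (y ω) * (1 / R ω ^ 2) := by gcongr
    _ = (∫ ω, Q (y ω) ∂μ) * ∫ ω, 1 / R ω ^ 2 ∂μ :=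
        indQ.integral_fun_mul_eq_mul_integral iQ.1 hRint.1
    _ ≤ _ := by
        refine mul_le_mul hQ hK (integral_nonneg fun ω => by positivity) ?_
        exact (integral_nonneg fun ω => hQ0 _).trans hQ

lemma integrable_and_integral_le_of_lintegral_le {Ω : Type*} [MeasurableSpace Ω] {μ : Measure Ω}
    {f : Ω → ℝ} (hf : AEStronglyMeasurable f μ) (h0 : 0 ≤ᵐ[μ] f) {C : ℝ} (hC : 0 ≤ C)
    (h : ∫⁻ ω, ENNReal.ofReal (f ω) ∂μ ≤ ENNReal.ofReal C) :
    Integrable f μ ∧ ∫ ω, f ω ∂μ ≤ C := by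
  refine ⟨⟨hf, (hasFiniteIntegral_iff_ofReal h0).2 (h.trans_lt ENNReal.ofReal_lt_top)⟩, ?_⟩
  rw [integral_eq_lintegral_of_nonneg_ae h0 hf]
  exact ENNReal.toReal_le_of_le_ofReal hC h

/-! ### Risk bound for one component law -/

section component

variable {d : ℕ} {v C₄ K : ℝ} {θ : EuclideanSpace ℝ (Fin d)}
  {m : Measure (EuclideanSpace ℝ (Fin d))}

/-- The integrand of the inverse moment equals ∞ where the sum vanishes, because d/0 = ∞ for d > 0;
its integral being finite, this set is null. -/
lemma IsComponentLaw.ae_erase_pos (h : IsComponentLaw d v θ C₄ K m) (hd : 0 < d) (i : Fin d) :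
    ∀ᵐ y ∂m, 0 < ∑ j ∈ Finset.univ.erase i, (y j + θ j) ^ 2 := by
  have hlt := (h.inverse_moment i).trans_lt ENNReal.ofReal_lt_top
  have hae := ae_lt_top (by fun_prop) hlt.ne
  filter_upwards [hae] with y hy
  by_contra hneg
  rw [ENNReal.ofReal_of_nonpos (not_lt.1 hneg), ENNReal.div_zero (by exact_mod_cast hd.ne')] at hy
  simp at hy

lemma IsComponentLaw.inverse_sq (h : IsComponentLaw d v θ C₄ K m) (hd : 0 < d) (hK : 0 ≤ K)
    (i : Fin d) :
    Integrable (fun y => 1 / (∑ j ∈ Finset.univ.erase i, (y j + θ j) ^ 2) ^ 2) m ∧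
      ∫ y, 1 / (∑ j ∈ Finset.univ.erase i, (y j + θ j) ^ 2) ^ 2 ∂m ≤ K / (d : ℝ) ^ 2 := by
  have hd' : (0 : ℝ) < d := by exact_mod_cast hd
  have hmeas : Measurable (fun y : EuclideanSpace ℝ (Fin d) =>
      ∑ j ∈ Finset.univ.erase i, (y j + θ j) ^ 2) := by fun_prop
  have := integrable_and_integral_le_of_lintegral_le (μ := m)
    (f := fun y => (d : ℝ) ^ 2 * (1 / (∑ j ∈ Finset.univ.erase i, (y j + θ j) ^ 2) ^ 2))
    (Measurable.aestronglyMeasurable (by fun_prop)) (ae_of_all _ fun y => by positivity) hK (by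
      refine le_trans (le_of_eq (lintegral_congr_ae ?_)) (h.inverse_moment i)
      filter_upwards [h.ae_erase_pos hd i] with y hy
      rw [mul_one_div, ← div_pow, ENNReal.ofReal_pow (by positivity), ENNReal.ofReal_div_of_pos hy,
        ENNReal.ofReal_natCast])
  obtain ⟨h1, h2⟩ := this
  have hne : ((d : ℝ) ^ 2) ≠ 0 := by positivity
  rw [integral_const_mul] at h2
  refine ⟨(integrable_const_mul_iff (Ne.isUnit hne) _).1 h1, ?_⟩
  rw [le_div_iff₀ (by positivity)]
  linarith

lemma IsComponentLaw.fourth (h : IsComponentLaw d v θ C₄ K m) (hC : 0 ≤ C₄) (i : Fin d) :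
    Integrable (fun y => y i ^ 4) m ∧ ∫ y, y i ^ 4 ∂m ≤ C₄ :=
  integrable_and_integral_le_of_lintegral_le (Measurable.aestronglyMeasurable (by fun_prop))
    (ae_of_all _ fun y => by positivity) hC (h.fourth_moment i)

lemma IsComponentLaw.integral_sq (h : IsComponentLaw d v θ C₄ K m) (i : Fin d) :
    ∫ y, y i ^ 2 ∂m = v := by
  have h1 := h.covariance_eq i i
  rw [covariance_self (Measurable.aemeasurable (by fun_prop)),
    variance_of_integral_eq_zero (Measurable.aemeasurable (by fun_prop)) (h.mean_zero i)] at h1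
  simpa using h1

lemma IsComponentLaw.indep_erase (h : IsComponentLaw d v θ C₄ K m) (i : Fin d) :
    IndepFun (fun y : EuclideanSpace ℝ (Fin d) => y i)
      (fun y => ∑ j ∈ Finset.univ.erase i, (y j + θ j) ^ 2) m := by
  have h1 := h.indep.indepFun_finset {i} (Finset.univ.erase i) (by simp) (fun j => by fun_prop)
  have hφ : Measurable fun f : ↥({i} : Finset (Fin d)) → ℝ => f ⟨i, by simp⟩ :=
    measurable_pi_apply _
  have hψ : Measurable fun f : ↥(Finset.univ.erase i) → ℝ => ∑ j, (f j + θ j) ^ 2 := by fun_prop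
  have h2 := h1.comp hφ hψ
  convert! h2 using 1
  ext y
  exact (Finset.sum_coe_sort (Finset.univ.erase i) (fun j => (y j + θ j) ^ 2)).symm

/-- Stein's computation with the approximate identity applied in each coordinate; the term with `K`
collects the d errors. -/
lemma IsComponentLaw.lintegral_shrinkage_le (h : IsComponentLaw d v θ C₄ K m) (hd : 3 ≤ d)
    (hv : 0 < v) (hC : 0 ≤ C₄) (hK : 0 ≤ K) {s : ℝ} (hs : 0 < s) :
    ∫⁻ y, ENNReal.ofReal (‖shrinkage (((d : ℝ) - 2) * v) (y + θ) - θ‖ ^ 2) ∂m ≤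
      ENNReal.ofReal (d * v - (((d : ℝ) - 2) * v) ^ 2 / (d * v + ‖θ‖ ^ 2)
        + 2 * (((d : ℝ) - 2) * v) * ((d * (C₄ + 5 * v ^ 2)
          + (∑ i, |θ i|) * (3 / 2 * (s * v + C₄ / s) + 5 * v * (s + v / s)))
            * (K / (d : ℝ) ^ 2))) := by
  have := h.isProbabilityMeasure
  have hd0 : 0 < d := by omega
  have hd3 : (3 : ℝ) ≤ d := by exact_mod_cast hd
  set B := 3 / 2 * (s * v + C₄ / s) + 5 * v * (s + v / s) with hB
  set lam := ((d : ℝ) - 2) * v with hlam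
  have hlam0 : 0 ≤ lam := mul_nonneg (by linarith) hv.le
  let R : Fin d → EuclideanSpace ℝ (Fin d) → ℝ :=
    fun i y => ∑ j ∈ Finset.univ.erase i, (y j + θ j) ^ 2
  let N : EuclideanSpace ℝ (Fin d) → ℝ := fun y => ‖y + θ‖ ^ 2
  have hNR : ∀ i y, R i y + (y i + θ i) ^ 2 = N y := fun i y => by
    simp only [R, N, EuclideanSpace.real_norm_sq_eq, PiLp.add_apply]
    exact Finset.sum_erase_add _ _ (Finset.mem_univ i)
  have stein := fun i => abs_integral_mul_div_sub_le (μ := m)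
    (y := fun y : EuclideanSpace ℝ (Fin d) => y i) (R := R i) (by fun_prop) (by fun_prop)
    (h.ae_erase_pos hd0 i) (h.inverse_sq hd0 hK i).1 (h.indep_erase i) (h.memLp_two i)
    (h.fourth hC i).1 (h.mean_zero i) (h.integral_sq i) (h.fourth hC i).2
    (h.inverse_sq hd0 hK i).2 (θ i) hs
  simp only [hNR] at stein
  have hpos : ∀ᵐ y ∂m, 0 < N y := by
    filter_upwards [h.ae_erase_pos hd0 ⟨0, hd0⟩] with y hy
    rw [← hNR ⟨0, hd0⟩ y]
    have : 0 < R ⟨0, hd0⟩ y := hy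
    positivity
  -- Divergence of x/‖x‖².
  have hdiv : ∀ᵐ y ∂m, ∑ i, (R i y - (y i + θ i) ^ 2) / N y ^ 2 = ((d : ℝ) - 2) * (1 / N y) := by
    filter_upwards [hpos] with y hy
    have e : ∀ i, R i y - (y i + θ i) ^ 2 = N y - 2 * (y i + θ i) ^ 2 := fun i => by
      rw [← hNR i y]; ring
    have e2 : ∑ i, (y i + θ i) ^ 2 = N y := by
      simp only [N, EuclideanSpace.real_norm_sq_eq, PiLp.add_apply]
    simp_rw [e]
    rw [← Finset.sum_div, Finset.sum_sub_distrib, ← Finset.mul_sum, e2]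
    simp only [Finset.sum_const, Finset.card_univ, Fintype.card_fin, nsmul_eq_mul]
    field_simp
  have isum : Integrable (fun y => ∑ i, (R i y - (y i + θ i) ^ 2) / N y ^ 2) m :=
    integrable_finsetSum _ fun i _ => (stein i).2.1
  -- Integrability of 1/‖X‖² is read off from the divergence, whose factor d-2 is nonzero since d ≥
  -- 3.
  have iN : Integrable (fun y => 1 / N y) m := by
    have : Integrable (fun y => ((d : ℝ) - 2) * (1 / N y)) m := isum.congr hdiv
    exact (integrable_const_mul_iff (Ne.isUnit (by linarith)) _).1 this
  have hsumg : ∑ i, ∫ y, (R i y - (y i + θ i) ^ 2) / N y ^ 2 ∂m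
      = ((d : ℝ) - 2) * ∫ y, 1 / N y ∂m := by
    rw [← integral_finsetSum _ fun i _ => (stein i).2.1, integral_congr_ae hdiv,
      integral_const_mul]
  have iN1 : Integrable N m ∧ ∫ y, N y ∂m = d * v + ‖θ‖ ^ 2 := by
    have e : N = fun y => ∑ i, (y i ^ 2 + (2 * θ i * y i + θ i ^ 2)) := by
      ext y
      simp only [N, EuclideanSpace.real_norm_sq_eq, PiLp.add_apply]
      exact Finset.sum_congr rfl fun i _ => by ring
    have i1 : ∀ i : Fin d, Integrable (fun y : EuclideanSpace ℝ (Fin d) => y i) m :=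
      fun i => (h.memLp_two i).integrable (by norm_num)
    have i2 : ∀ i : Fin d, Integrable (fun y : EuclideanSpace ℝ (Fin d) =>
        2 * θ i * y i + θ i ^ 2) m := fun i => ((i1 i).const_mul _).add (integrable_const _)
    have i3 : ∀ i : Fin d, Integrable (fun y : EuclideanSpace ℝ (Fin d) =>
        y i ^ 2 + (2 * θ i * y i + θ i ^ 2)) m := fun i => (h.memLp_two i).integrable_sq.add (i2 i)
    rw [e]
    refine ⟨integrable_finsetSum _ fun i _ => i3 i, ?_⟩
    rw [integral_finsetSum _ fun i _ => i3 i, EuclideanSpace.real_norm_sq_eq]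
    have : ∀ i : Fin d, ∫ y : EuclideanSpace ℝ (Fin d), (y i ^ 2 + (2 * θ i * y i + θ i ^ 2)) ∂m
        = v + θ i ^ 2 := fun i => by
      rw [integral_add (h.memLp_two i).integrable_sq (i2 i),
        integral_add ((i1 i).const_mul _) (integrable_const _), integral_const_mul, h.mean_zero i,
        h.integral_sq i]
      simp
    simp_rw [this]
    rw [Finset.sum_add_distrib]
    simp
  set M := d * v + ‖θ‖ ^ 2 with hM
  have hMpos : 0 < M := by positivity
  -- Jensen's inequality through the tangent line of 1/x at M.
  have jensen : 1 / M ≤ ∫ y, 1 / N y ∂m := by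
    have i2 : Integrable (fun y => 2 / M - N y / M ^ 2) m :=
      (integrable_const _).sub (iN1.1.div_const _)
    have : ∫ y, (2 / M - N y / M ^ 2) ∂m ≤ ∫ y, 1 / N y ∂m := by
      refine integral_mono_ae i2 iN ?_
      filter_upwards [hpos] with y hy
      have : 1 / N y - (2 / M - N y / M ^ 2) = (N y - M) ^ 2 / (N y * M ^ 2) := by
        field_simp; ring
      have h2 : 0 ≤ (N y - M) ^ 2 / (N y * M ^ 2) := by positivity
      show 2 / M - N y / M ^ 2 ≤ 1 / N y
      linarith
    rw [integral_sub (integrable_const _) (iN1.1.div_const _), integral_div (M ^ 2) N,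
      iN1.2] at this
    simp only [integral_const, probReal_univ, one_smul] at this
    refine le_trans (le_of_eq ?_) this
    field_simp
    ring
  have isummand : ∀ i : Fin d, Integrable (fun y : EuclideanSpace ℝ (Fin d) =>
      y i ^ 2 - 2 * lam * (y i * ((y i + θ i) / N y))) m := fun i =>
    (h.memLp_two i).integrable_sq.sub ((stein i).1.const_mul _)
  have iF : Integrable (fun y => ∑ i, (y i ^ 2 - 2 * lam * (y i * ((y i + θ i) / N y)))
      + lam ^ 2 * (1 / N y)) m :=
    (integrable_finsetSum _ fun i _ => isummand i).add (iN.const_mul _)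
  have hF : ∀ᵐ y ∂m, ‖shrinkage lam (y + θ) - θ‖ ^ 2
      = ∑ i, (y i ^ 2 - 2 * lam * (y i * ((y i + θ i) / N y))) + lam ^ 2 * (1 / N y) := by
    filter_upwards [hpos] with y hy
    have e2 : ∑ i, (y i + θ i) ^ 2 = N y := by
      simp only [N, EuclideanSpace.real_norm_sq_eq, PiLp.add_apply]
    have e3 : lam ^ 2 * (1 / N y) = ∑ i, lam ^ 2 / N y ^ 2 * (y i + θ i) ^ 2 := by
      rw [← Finset.mul_sum, e2]; field_simp
    rw [e3, ← Finset.sum_add_distrib, EuclideanSpace.real_norm_sq_eq]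
    refine Finset.sum_congr rfl fun i _ => ?_
    have : (shrinkage lam (y + θ) - θ) i = (1 - lam / N y) * (y i + θ i) - θ i := by
      simp only [shrinkage, N, PiLp.sub_apply, PiLp.smul_apply, PiLp.add_apply, smul_eq_mul]
    rw [this]
    field_simp
    ring
  have hF0 : ∀ᵐ y ∂m, 0 ≤ ∑ i, (y i ^ 2 - 2 * lam * (y i * ((y i + θ i) / N y)))
      + lam ^ 2 * (1 / N y) := by
    filter_upwards [hF] with y hy
    rw [← hy]; positivity
  rw [lintegral_congr_ae (hF.mono fun y hy => congrArg ENNReal.ofReal hy),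
    ← ofReal_integral_eq_lintegral_ofReal iF hF0]
  refine ENNReal.ofReal_le_ofReal ?_
  rw [integral_add (integrable_finsetSum _ fun i _ => isummand i) (iN.const_mul _),
    integral_finsetSum _ fun i _ => isummand i, integral_const_mul]
  have hi : ∀ i : Fin d, ∫ y : EuclideanSpace ℝ (Fin d),
      (y i ^ 2 - 2 * lam * (y i * ((y i + θ i) / N y))) ∂m ≤
      v - 2 * lam * (v * ∫ y, (R i y - (y i + θ i) ^ 2) / N y ^ 2 ∂m)
        + 2 * lam * ((C₄ + 5 * v ^ 2 + |θ i| * B) * (K / (d : ℝ) ^ 2)) := fun i => by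
    rw [integral_sub (h.memLp_two i).integrable_sq ((stein i).1.const_mul _), integral_const_mul,
      h.integral_sq i]
    have h1 := (abs_le.1 (stein i).2.2).1
    rw [← hB] at h1
    have h2 := mul_le_mul_of_nonneg_left h1 (by positivity : 0 ≤ 2 * lam)
    linarith
  have hsum := Finset.sum_le_sum fun i (_ : i ∈ (Finset.univ : Finset (Fin d))) => hi i
  rw [Finset.sum_add_distrib, Finset.sum_sub_distrib, ← Finset.mul_sum, ← Finset.mul_sum,
    ← Finset.mul_sum, hsumg, ← Finset.sum_mul, Finset.sum_add_distrib, ← Finset.sum_mul] at hsum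
  simp only [Finset.sum_const, Finset.card_univ, Fintype.card_fin, nsmul_eq_mul] at hsum
  have hJ := mul_le_mul_of_nonneg_left jensen (sq_nonneg lam)
  -- The choice λ = (d-2)v turns the cross term into -2λ² E[1/N], hence -λ² E[1/N] in total.
  have hl : v * (((d : ℝ) - 2) * ∫ y, 1 / N y ∂m) = lam * ∫ y, 1 / N y ∂m := by rw [hlam]; ring
  rw [hl] at hsum
  have : lam ^ 2 / M = lam ^ 2 * (1 / M) := by ring
  rw [this]
  linarith

end component

/-! ### Passage to mixtures and the explicit bound -/

lemma measurable_shrinkage {d : ℕ} (lam : ℝ) :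
    Measurable (shrinkage lam : EuclideanSpace ℝ (Fin d) → EuclideanSpace ℝ (Fin d)) := by
  unfold shrinkage
  fun_prop

/-- The risk is an average of the component risks, so a bound uniform over components survives. -/
lemma risk_le_of_mem_mixtureClass {d : ℕ} {v C₄ K : ℝ} {θ : EuclideanSpace ℝ (Fin d)}
    {P : Measure (EuclideanSpace ℝ (Fin d))} (hP : P ∈ mixtureClass d v C₄ K θ)
    {T : EuclideanSpace ℝ (Fin d) → EuclideanSpace ℝ (Fin d)} (hT : Measurable T) {b : ℝ≥0∞}
    (hb : ∀ m, IsComponentLaw d v θ C₄ K m →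
      ∫⁻ y, ENNReal.ofReal (‖T (y + θ) - θ‖ ^ 2) ∂m ≤ b) :
    risk P θ T ≤ b := by
  obtain ⟨S, _, μ, m, hμ, hm, rfl⟩ := hP
  have hmeas : Measurable fun x => ENNReal.ofReal (‖T x - θ‖ ^ 2) := by fun_prop
  rw [risk, lintegral_map hmeas (by fun_prop), Measure.lintegral_bind m.measurable.aemeasurable
    (Measurable.aemeasurable (by fun_prop))]
  calc _ ≤ ∫⁻ _, b ∂μ := lintegral_mono fun s => hb _ (hm s)
    _ = b := by simp

/-- The risk of the James–Stein estimator over the mixture class, with explicit constants. -/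
lemma risk_shrinkage_le {σ C₄ K : ℝ} (hσ : 0 < σ) (hC : 0 ≤ C₄) (hK : 0 ≤ K) {d : ℕ} (hd : 3 ≤ d)
    {θ : EuclideanSpace ℝ (Fin d)} {P : Measure (EuclideanSpace ℝ (Fin d))}
    (hP : P ∈ mixtureClass d (σ ^ 2 / d) C₄ K θ) {s : ℝ} (hs : 0 < s) :
    risk P θ (shrinkage (((d : ℝ) - 2) * (σ ^ 2 / d))) ≤
      ENNReal.ofReal (σ ^ 2 / (σ ^ 2 + ‖θ‖ ^ 2) * (‖θ‖ ^ 2 + 4 * σ ^ 2 / d)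
        + 2 * (((d : ℝ) - 2) * (σ ^ 2 / d)) * ((d * (C₄ + 5 * (σ ^ 2 / d) ^ 2)
          + (∑ i, |θ i|) * (3 / 2 * (s * (σ ^ 2 / d) + C₄ / s)
            + 5 * (σ ^ 2 / d) * (s + σ ^ 2 / d / s))) * (K / (d : ℝ) ^ 2))) := by
  have hd0 : (0 : ℝ) < d := by exact_mod_cast (by omega : 0 < d)
  refine risk_le_of_mem_mixtureClass hP (measurable_shrinkage _) fun m hm =>
    (hm.lintegral_shrinkage_le hd (by positivity) hC hK hs).trans (ENNReal.ofReal_le_ofReal ?_)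
  gcongr
  have hM : 0 < σ ^ 2 + ‖θ‖ ^ 2 := by positivity
  have e : (d : ℝ) * (σ ^ 2 / d) = σ ^ 2 := by field_simp
  rw [e]
  -- From (1-2/d)² = 1 - 4/d + 4/d²; the last term is nonnegative slack.
  have : σ ^ 2 / (σ ^ 2 + ‖θ‖ ^ 2) * (‖θ‖ ^ 2 + 4 * σ ^ 2 / d)
      - (σ ^ 2 - (((d : ℝ) - 2) * (σ ^ 2 / d)) ^ 2 / (σ ^ 2 + ‖θ‖ ^ 2))
      = 4 * σ ^ 4 / d ^ 2 / (σ ^ 2 + ‖θ‖ ^ 2) := by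
    field_simp
    ring
  have h2 : 0 ≤ 4 * σ ^ 4 / (d : ℝ) ^ 2 / (σ ^ 2 + ‖θ‖ ^ 2) := by positivity
  linarith

lemma exists_risk_shrinkage_le {σ C₄ K : ℝ} (hσ : 0 < σ) (hC : 0 < C₄) (hK : 0 < K) :
    ∃ L : ℝ, 0 < L ∧ ∀ d : ℕ, 3 ≤ d → ∀ θ : EuclideanSpace ℝ (Fin d),
      ∀ P ∈ mixtureClass d (σ ^ 2 / d) C₄ K θ,
        risk P θ (shrinkage (((d : ℝ) - 2) * (σ ^ 2 / d))) ≤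
          ENNReal.ofReal (σ ^ 2 / (σ ^ 2 + ‖θ‖ ^ 2) * (‖θ‖ ^ 2 + 4 * σ ^ 2 / d)
            + L * (((d : ℝ) - 2) * (σ ^ 2 / d))
              * (1 / d + (∑ i, |θ i|) / (d : ℝ) ^ 2 + ‖θ‖ ^ 2 / (d : ℝ) ^ 3)) := by
  -- These are the error coefficients at `s = 1`, with σ²/d enlarged to σ².
  set A := C₄ + 5 * (σ ^ 2) ^ 2
  set B := 3 / 2 * (1 * σ ^ 2 + C₄ / 1) + 5 * σ ^ 2 * (1 + σ ^ 2 / 1)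
  refine ⟨2 * K * (A + B), by positivity, fun d hd θ P hP =>
    (risk_shrinkage_le hσ hC.le hK.le hd hP one_pos).trans (ENNReal.ofReal_le_ofReal ?_)⟩
  have hd3 : (3 : ℝ) ≤ d := by exact_mod_cast hd
  have hd0 : (0 : ℝ) < d := by linarith
  have hv : σ ^ 2 / d ≤ σ ^ 2 := div_le_self (by positivity) (by linarith)
  have hlam : 0 ≤ ((d : ℝ) - 2) * (σ ^ 2 / d) := mul_nonneg (by linarith) (by positivity)
  have hn : 0 ≤ ∑ i, |θ i| := Finset.sum_nonneg fun i _ => abs_nonneg _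
  refine add_le_add_right ?_ _
  calc _ ≤ 2 * (((d : ℝ) - 2) * (σ ^ 2 / d)) * ((d * A + (∑ i, |θ i|) * B)
          * (K / (d : ℝ) ^ 2)) := by
        gcongr
        · simp only [A]; gcongr
        · simp only [B]; gcongr
    _ ≤ 2 * (((d : ℝ) - 2) * (σ ^ 2 / d)) * ((d * (A + B) + (∑ i, |θ i|) * (A + B))
          * (K / (d : ℝ) ^ 2)) := by
        have : 0 ≤ A := by positivity
        have : 0 ≤ B := by positivity
        gcongr <;> linarith
    _ = 2 * K * (A + B) * (((d : ℝ) - 2) * (σ ^ 2 / d))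
          * (1 / d + (∑ i, |θ i|) / (d : ℝ) ^ 2) := by
        field_simp
    _ ≤ _ := by
        -- The term ‖θ‖²/d³ is pure slack here.
        refine mul_le_mul_of_nonneg_left ?_ (by positivity)
        have : 0 ≤ ‖θ‖ ^ 2 / (d : ℝ) ^ 3 := by positivity
        linarith

/-! ### Gaussian moments and the Bayes risk -/

section gaussian

lemma multivariateGaussian_smul_one {ι : Type*} [Fintype ι] [DecidableEq ι]
    (θ : EuclideanSpace ℝ ι) {s : ℝ} (hs : 0 ≤ s) :
    multivariateGaussian θ (s ^ 2 • (1 : Matrix ι ι ℝ))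
      = (stdGaussian (EuclideanSpace ℝ ι)).map (fun x => θ + s • x) := by
  open scoped MatrixOrder in
  have h : CFC.sqrt (s ^ 2 • (1 : Matrix ι ι ℝ)) = s • (1 : Matrix ι ι ℝ) := by
    refine CFC.sqrt_unique ?_ ?_
    · rw [smul_mul_smul_comm, one_mul, sq]
    · exact (Matrix.PosSemidef.one.smul hs).nonneg
  rw [multivariateGaussian, h]
  simp

lemma stdGaussian_integral_norm_sq (d : ℕ) :
    Integrable (fun u => ‖u‖ ^ 2) (stdGaussian (EuclideanSpace ℝ (Fin d))) ∧
      ∫ u, ‖u‖ ^ 2 ∂(stdGaussian (EuclideanSpace ℝ (Fin d))) = d := by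
  have hi : ∀ i : Fin d, Integrable (fun x : Fin d → ℝ => x i ^ 2)
      (Measure.pi fun _ => gaussianReal 0 1) := fun i =>
    integrable_comp_eval (μ := fun _ : Fin d => gaussianReal 0 1) (i := i)
      (f := fun x : ℝ => x ^ 2) (memLp_id_gaussianReal (μ := 0) (v := 1) 2).integrable_sq
  have hv : ∫ x, x ^ 2 ∂(gaussianReal 0 1) = 1 := by
    have := variance_id_gaussianReal (μ := 0) (v := 1)
    rw [variance_of_integral_eq_zero aemeasurable_id (by simp)] at this
    simpa using this
  rw [← map_pi_eq_stdGaussian, integrable_map_measure (by fun_prop) (by fun_prop),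
    integral_map (by fun_prop) (by fun_prop)]
  simp only [Function.comp_def, EuclideanSpace.real_norm_sq_eq]
  refine ⟨integrable_finsetSum _ fun i _ => hi i, ?_⟩
  rw [integral_finsetSum _ fun i _ => hi i]
  have : ∀ i : Fin d, ∫ x : Fin d → ℝ, x i ^ 2 ∂(Measure.pi fun _ => gaussianReal 0 1) = 1 :=
    fun i => by
      rw [← hv]
      exact integral_comp_eval (μ := fun _ : Fin d => gaussianReal 0 1) (i := i)
        (f := fun x : ℝ => x ^ 2) (by fun_prop)
  simp [this]

/-- Linear growth in d is what makes the truncation of the prior negligible; the variance of the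
squared Gaussian is never evaluated. -/
lemma stdGaussian_lintegral_norm_sq_sub_sq (d : ℕ) :
    ∫⁻ u, ENNReal.ofReal ((‖u‖ ^ 2 - d) ^ 2) ∂(stdGaussian (EuclideanSpace ℝ (Fin d)))
      = ENNReal.ofReal (d * Var[fun x => x ^ 2; gaussianReal 0 1]) := by
  have h4 : MemLp (fun x : ℝ => x ^ 2) 2 (gaussianReal 0 1) := by
    refine (memLp_two_iff_integrable_sq (by fun_prop)).2 ?_
    have h : MemLp (id : ℝ → ℝ) (4 : ℕ) (gaussianReal 0 1) := memLp_id_gaussianReal' _ (by simp)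
    refine (h.integrable_norm_pow (by norm_num)).congr (ae_of_all _ fun x => ?_)
    simp only [id, Real.norm_eq_abs]
    rw [← pow_mul, Even.pow_abs (by decide)]
  have hmem : MemLp (fun x : Fin d → ℝ => ∑ i, x i ^ 2) 2
      (Measure.pi fun _ => gaussianReal 0 1) :=
    memLp_finsetSum _ fun i _ => h4.comp_measurePreserving (measurePreserving_eval _ i)
  have hmean : ∫ x : Fin d → ℝ, ∑ i, x i ^ 2 ∂(Measure.pi fun _ => gaussianReal 0 1) = d := by
    have := (stdGaussian_integral_norm_sq d).2
    rw [← map_pi_eq_stdGaussian, integral_map (by fun_prop) (by fun_prop)] at this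
    simpa only [EuclideanSpace.real_norm_sq_eq] using this
  have hvar : Var[fun x : Fin d → ℝ => ∑ i, x i ^ 2; Measure.pi fun _ => gaussianReal 0 1]
      = d * Var[fun x => x ^ 2; gaussianReal 0 1] := by
    have := variance_sum_pi (μ := fun _ : Fin d => gaussianReal 0 1)
      (X := fun _ x => x ^ 2) (fun _ => h4)
    rw [← Finset.sum_fn, this]
    simp
  rw [← hvar, hmem.ofReal_variance_eq, evariance_eq_lintegral_ofReal, hmean,
    ← map_pi_eq_stdGaussian, lintegral_map (by fun_prop) (by fun_prop)]
  simp only [EuclideanSpace.real_norm_sq_eq]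

/-- The best constant predictor of a scaled standard Gaussian vector is zero. -/
lemma le_stdGaussian_lintegral_norm_add_sq {d : ℕ} (a : EuclideanSpace ℝ (Fin d)) (r : ℝ) :
    ENNReal.ofReal (r ^ 2 * d) ≤
      ∫⁻ u, ENNReal.ofReal (‖a + r • u‖ ^ 2) ∂(stdGaussian (EuclideanSpace ℝ (Fin d))) := by
  obtain ⟨h1, h2⟩ := stdGaussian_integral_norm_sq d
  set γ := stdGaussian (EuclideanSpace ℝ (Fin d))
  have i1 : Integrable (fun u => inner ℝ a u) γ :=
    (innerSL ℝ a).integrable_comp IsGaussian.integrable_id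
  have z1 : ∫ u, inner ℝ a u ∂γ = 0 := integral_strongDual_stdGaussian (innerSL ℝ a)
  have e : (fun u => ‖a + r • u‖ ^ 2)
      = fun u => (‖a‖ ^ 2 + 2 * r * inner ℝ a u) + r ^ 2 * ‖u‖ ^ 2 := by
    ext u
    rw [norm_add_sq_real, inner_smul_right, norm_smul, mul_pow, Real.norm_eq_abs, sq_abs]
    ring
  have i2 : Integrable (fun u => ‖a‖ ^ 2 + 2 * r * inner ℝ a u) γ :=
    (integrable_const _).add (i1.const_mul _)
  have i3 : Integrable (fun u => ‖a + r • u‖ ^ 2) γ := by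
    rw [e]; exact i2.add (h1.const_mul _)
  rw [← ofReal_integral_eq_lintegral_ofReal i3 (ae_of_all _ fun u => by positivity), e,
    integral_add i2 (h1.const_mul _), integral_add (integrable_const _) (i1.const_mul _),
    integral_const_mul, integral_const_mul, z1, h2]
  refine ENNReal.ofReal_le_ofReal ?_
  simp

/-- Lower bound for the Bayes risk in the Gaussian location model with a Gaussian prior. -/
lemma le_bayesRisk_stdGaussian {d : ℕ} {b s : ℝ} (hb : 0 < b)
    {T : EuclideanSpace ℝ (Fin d) → EuclideanSpace ℝ (Fin d)} (hT : Measurable T) :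
    ENNReal.ofReal (b ^ 2 * s ^ 2 / (b ^ 2 + s ^ 2) * d) ≤
      ∫⁻ u, ∫⁻ w, ENNReal.ofReal (‖T (b • u + s • w) - b • u‖ ^ 2)
        ∂(stdGaussian (EuclideanSpace ℝ (Fin d))) ∂(stdGaussian (EuclideanSpace ℝ (Fin d))) := by
  set γ := stdGaussian (EuclideanSpace ℝ (Fin d))
  -- The argument of b - is is the rotation angle that carries the observation bu + sw to a multiple
  -- of the first vector. The second vector is then independent of the observation and carries the
  -- unpredictable part of bu.
  let z : ℂ := ⟨b, -s⟩
  have hz : z ≠ 0 := fun h => hb.ne' (congrArg Complex.re h)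
  have hr : 0 < ‖z‖ := norm_pos_iff.2 hz
  have hr2 : ‖z‖ ^ 2 = b ^ 2 + s ^ 2 := by
    rw [Complex.sq_norm, Complex.normSq_apply]; ring
  have hc : Real.cos z.arg = b / ‖z‖ := Complex.cos_arg hz
  have hs : Real.sin z.arg = -s / ‖z‖ := Complex.sin_arg z
  have hrot : (γ.prod γ).map (ContinuousLinearMap.rotation z.arg) = γ.prod γ :=
    IsGaussian.map_rotation_eq_self_of_forall_strongDual_eq_zero
      integral_strongDual_stdGaussian z.arg
  have hmeas : Measurable fun p : EuclideanSpace ℝ (Fin d) × EuclideanSpace ℝ (Fin d) =>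
      ENNReal.ofReal (‖T (b • p.1 + s • p.2) - b • p.1‖ ^ 2) := by fun_prop
  have hmeas2 : Measurable fun p : EuclideanSpace ℝ (Fin d) × EuclideanSpace ℝ (Fin d) =>
      ENNReal.ofReal (‖(T (‖z‖ • p.1) - (b ^ 2 / ‖z‖) • p.1) + (b * s / ‖z‖) • p.2‖ ^ 2) := by
    fun_prop
  have hx : ∀ p : EuclideanSpace ℝ (Fin d) × EuclideanSpace ℝ (Fin d),
      b • (ContinuousLinearMap.rotation z.arg p).1
        + s • (ContinuousLinearMap.rotation z.arg p).2 = ‖z‖ • p.1 := fun p => by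
    rw [ContinuousLinearMap.rotation_apply, hc, hs]
    have : ‖z‖ • p.1 = ((b ^ 2 + s ^ 2) / ‖z‖) • p.1 := by
      congr 1; rw [← hr2]; field_simp
    rw [this]
    simp only
    module
  have hy : ∀ p : EuclideanSpace ℝ (Fin d) × EuclideanSpace ℝ (Fin d),
      b • (ContinuousLinearMap.rotation z.arg p).1
        = (b ^ 2 / ‖z‖) • p.1 - (b * s / ‖z‖) • p.2 := fun p => by
    rw [ContinuousLinearMap.rotation_apply, hc, hs]
    simp only
    module
  calc ENNReal.ofReal (b ^ 2 * s ^ 2 / (b ^ 2 + s ^ 2) * d)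
      = ∫⁻ _ : EuclideanSpace ℝ (Fin d), ENNReal.ofReal ((b * s / ‖z‖) ^ 2 * d) ∂γ := by
        rw [lintegral_const, measure_univ, mul_one, div_pow, mul_pow, hr2]
    _ ≤ ∫⁻ u, ∫⁻ w, ENNReal.ofReal
          (‖(T (‖z‖ • u) - (b ^ 2 / ‖z‖) • u) + (b * s / ‖z‖) • w‖ ^ 2) ∂γ ∂γ :=
        lintegral_mono fun u => le_stdGaussian_lintegral_norm_add_sq _ _
    _ = ∫⁻ p, ENNReal.ofReal
          (‖(T (‖z‖ • p.1) - (b ^ 2 / ‖z‖) • p.1) + (b * s / ‖z‖) • p.2‖ ^ 2) ∂(γ.prod γ) :=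
        (lintegral_prod _ hmeas2.aemeasurable).symm
    _ = ∫⁻ p, ENNReal.ofReal (‖T (b • (ContinuousLinearMap.rotation z.arg p).1
          + s • (ContinuousLinearMap.rotation z.arg p).2)
          - b • (ContinuousLinearMap.rotation z.arg p).1‖ ^ 2) ∂(γ.prod γ) := by
        refine lintegral_congr fun p => ?_
        rw [hx, hy]
        congr 3
        abel
    _ = ∫⁻ p, ENNReal.ofReal (‖T (b • p.1 + s • p.2) - b • p.1‖ ^ 2)
          ∂((γ.prod γ).map (ContinuousLinearMap.rotation z.arg)) :=
        (lintegral_map hmeas (by fun_prop)).symm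
    _ = _ := by rw [hrot, lintegral_prod _ hmeas.aemeasurable]

end gaussian

/-! ### Retraction onto the parameter ball -/

/-- Radial retraction onto the ball of radius `c`. -/
noncomputable def ballRetract {E : Type*} [NormedAddCommGroup E] [NormedSpace ℝ E] (c : ℝ) (x : E) :
    E :=
  (min 1 (c / ‖x‖)) • x

section ballRetract

variable {E : Type*} [NormedAddCommGroup E] [InnerProductSpace ℝ E] {c : ℝ}

lemma norm_ballRetract_le (hc : 0 ≤ c) (x : E) : ‖ballRetract c x‖ ≤ c := by
  have h0 : 0 ≤ min 1 (c / ‖x‖) := le_min zero_le_one (by positivity)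
  rw [ballRetract, norm_smul, Real.norm_of_nonneg h0]
  calc min 1 (c / ‖x‖) * ‖x‖ ≤ c / ‖x‖ * ‖x‖ := by gcongr; exact min_le_right _ _
    _ ≤ c := by
        rcases eq_or_ne ‖x‖ 0 with h | h
        · simpa [h] using hc
        · rw [div_mul_cancel₀ _ h]

/-- For x outside the ball and t = c/‖x‖, the bound ⟨x, θ⟩ ≤ t‖x‖² gives ‖x-θ‖² - ‖tx-θ‖² ≥
(1-t)²‖x‖². -/
lemma norm_ballRetract_sub_le (x : E) {θ : E} (hθ : ‖θ‖ ≤ c) :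
    ‖ballRetract c x - θ‖ ≤ ‖x - θ‖ := by
  rcases le_or_gt 1 (c / ‖x‖) with h | h
  · rw [ballRetract, min_eq_left h, one_smul]
  · rw [ballRetract, min_eq_right h.le]
    -- Since c/0 = 0, the origin falls into this case.
    rcases eq_or_ne x 0 with rfl | hx
    · simp
    have hx0 : 0 < ‖x‖ := norm_pos_iff.2 hx
    set t := c / ‖x‖ with ht
    have htc : c = t * ‖x‖ := by rw [ht]; field_simp
    have hin : inner ℝ x θ ≤ ‖x‖ * c :=
      (real_inner_le_norm x θ).trans (by gcongr)
    refine le_of_sq_le_sq ?_ (norm_nonneg _)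
    rw [norm_sub_sq_real, norm_sub_sq_real, inner_smul_left, norm_smul, Real.norm_eq_abs, mul_pow,
      sq_abs]
    simp only [conj_trivial]
    have h1 := mul_le_mul_of_nonneg_left hin (sub_nonneg.2 h.le)
    rw [htc] at h1
    nlinarith [mul_nonneg (sub_nonneg.2 h.le) (mul_nonneg (sub_nonneg.2 h.le) (sq_nonneg ‖x‖))]

lemma measurable_ballRetract [MeasurableSpace E] [BorelSpace E] [SecondCountableTopology E] :
    Measurable (ballRetract c : E → E) := by
  unfold ballRetract
  fun_prop

end ballRetract

/-! ### Pinsker's lower bound by truncating a Gaussian prior -/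

/-- If the Gaussian location model of variance `s²` on the ball of radius `c` has maximal risk at
most `M` for some estimator, then the Bayes risk for the prior of coordinate variance `b²`, where
`d b² < c²`, exceeds `M` by at most a truncation error. -/
lemma bayesRisk_le_add {d : ℕ} {b s c : ℝ} (hc : 0 < c) (hb : 0 < b)
    (hbc : d * b ^ 2 < c ^ 2)
    {T : EuclideanSpace ℝ (Fin d) → EuclideanSpace ℝ (Fin d)} (hT : Measurable T) {M : ℝ≥0∞}
    (hM : ∀ θ : EuclideanSpace ℝ (Fin d), ‖θ‖ ≤ c →
      ∫⁻ w, ENNReal.ofReal (‖T (θ + s • w) - θ‖ ^ 2)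
        ∂(stdGaussian (EuclideanSpace ℝ (Fin d))) ≤ M) :
    ENNReal.ofReal (b ^ 2 * s ^ 2 / (b ^ 2 + s ^ 2) * d) ≤
      M + ENNReal.ofReal (4 * (1 + d * b ^ 2 / (c ^ 2 - d * b ^ 2)) / (c ^ 2 - d * b ^ 2) * b ^ 4
        * (d * Var[fun x => x ^ 2; gaussianReal 0 1])) := by
  set δ := c ^ 2 - d * b ^ 2 with hδdef
  have hδ : 0 < δ := sub_pos.2 hbc
  set C := 4 * (1 + d * b ^ 2 / δ) / δ * b ^ 4 with hC
  have hC0 : 0 ≤ C := by positivity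
  set γ := stdGaussian (EuclideanSpace ℝ (Fin d))
  have hpt : ∀ u : EuclideanSpace ℝ (Fin d),
      ∫⁻ w, ENNReal.ofReal (‖ballRetract c (T (b • u + s • w)) - b • u‖ ^ 2) ∂γ
        ≤ M + ENNReal.ofReal (C * (‖u‖ ^ 2 - d) ^ 2) := by
    intro u
    -- Inside the ball the retraction only reduces the loss and `hM` applies; outside, both vectors
    -- have norm at most ‖bu‖, so the loss is at most 4‖bu‖².
    rcases le_or_gt ‖b • u‖ c with h | h
    · refine le_trans (le_trans (lintegral_mono fun w => ENNReal.ofReal_le_ofReal ?_) (hM _ h))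
        le_self_add
      gcongr
      exact norm_ballRetract_sub_le _ h
    · refine le_trans ?_ le_add_self
      have hnorm : ‖b • u‖ ^ 2 = b ^ 2 * ‖u‖ ^ 2 := by
        rw [norm_smul, mul_pow, Real.norm_eq_abs, sq_abs]
      have hW : δ ≤ b ^ 2 * ‖u‖ ^ 2 - d * b ^ 2 := by
        rw [← hnorm, hδdef]
        gcongr
      set W := b ^ 2 * ‖u‖ ^ 2 - d * b ^ 2 with hWdef
      have hW0 : 0 < W := hδ.trans_le hW
      -- As in Chebyshev's inequality: the factor W/δ ≥ 1 is inserted twice to reach a multiple of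
      -- W².
      have hbound : 4 * ‖b • u‖ ^ 2 ≤ C * (‖u‖ ^ 2 - d) ^ 2 := by
        have e : C * (‖u‖ ^ 2 - d) ^ 2 = 4 * ((1 + d * b ^ 2 / δ) * (W * (W / δ))) := by
          rw [hC, hWdef]; field_simp
        have h1 : 1 ≤ W / δ := (one_le_div hδ).2 hW
        have h2 : ‖b • u‖ ^ 2 ≤ (1 + d * b ^ 2 / δ) * W := by
          calc ‖b • u‖ ^ 2 = W + d * b ^ 2 * 1 := by rw [hnorm, hWdef]; ring
            _ ≤ W + d * b ^ 2 * (W / δ) := by gcongr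
            _ = _ := by field_simp
        rw [e]
        gcongr
        calc ‖b • u‖ ^ 2 ≤ (1 + d * b ^ 2 / δ) * (W * 1) := by rw [mul_one]; exact h2
          _ ≤ _ := by gcongr
      calc _ ≤ ∫⁻ _, ENNReal.ofReal (C * (‖u‖ ^ 2 - d) ^ 2) ∂γ := by
            refine lintegral_mono fun w => ENNReal.ofReal_le_ofReal (le_trans ?_ hbound)
            have h3 : ‖ballRetract c (T (b • u + s • w)) - b • u‖ ≤ 2 * ‖b • u‖ := by
              have := norm_sub_le (ballRetract c (T (b • u + s • w))) (b • u)
              have := norm_ballRetract_le hc.le (T (b • u + s • w))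
              linarith
            calc _ ≤ (2 * ‖b • u‖) ^ 2 := by gcongr
              _ = _ := by ring
        _ = _ := by simp
  calc _ ≤ ∫⁻ u, ∫⁻ w, ENNReal.ofReal (‖ballRetract c (T (b • u + s • w)) - b • u‖ ^ 2) ∂γ ∂γ :=
        le_bayesRisk_stdGaussian hb (T := fun x => ballRetract c (T x))
          (measurable_ballRetract.comp hT)
    _ ≤ ∫⁻ u, (M + ENNReal.ofReal (C * (‖u‖ ^ 2 - d) ^ 2)) ∂γ := lintegral_mono hpt
    _ = M + ENNReal.ofReal (C * (d * Var[fun x => x ^ 2; gaussianReal 0 1])) := by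
        rw [lintegral_add_left measurable_const, lintegral_const, measure_univ, mul_one]
        simp_rw [ENNReal.ofReal_mul hC0]
        rw [lintegral_const_mul _ (by fun_prop), stdGaussian_lintegral_norm_sq_sub_sq]

/-- Pinsker's lower bound with a truncation error of order `1 / d`. -/
lemma exists_le_minimaxRisk {σ b c : ℝ} (hσ : 0 < σ) (hb : 0 < b) (hbc : b < c) :
    ∃ A : ℝ, 0 ≤ A ∧ ∀ d : ℕ, 0 < d →
      ∀ Q : EuclideanSpace ℝ (Fin d) → Set (Measure (EuclideanSpace ℝ (Fin d))),
        (∀ θ : EuclideanSpace ℝ (Fin d), ‖θ‖ ≤ c → multivariateGaussian θ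
          ((σ ^ 2 / (d : ℝ)) • (1 : Matrix (Fin d) (Fin d) ℝ)) ∈ Q θ) →
        ENNReal.ofReal (σ ^ 2 * b ^ 2 / (σ ^ 2 + b ^ 2) - A / d) ≤ minimaxRisk Q c := by
  have hδ : 0 < c ^ 2 - b ^ 2 := by nlinarith
  refine ⟨4 * (1 + b ^ 2 / (c ^ 2 - b ^ 2)) / (c ^ 2 - b ^ 2) * b ^ 4
    * Var[fun x => x ^ 2; gaussianReal 0 1],
    mul_nonneg (by positivity) (variance_nonneg _ _), fun d hd Q hQ => ?_⟩
  refine le_iInf₂ fun T hT => ?_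
  have hd0 : (0 : ℝ) < d := by exact_mod_cast hd
  have hs : 0 < √(d : ℝ) := Real.sqrt_pos.2 hd0
  have hs2 : √(d : ℝ) ^ 2 = d := Real.sq_sqrt hd0.le
  have hb2 : d * (b / √(d : ℝ)) ^ 2 = b ^ 2 := by rw [div_pow, hs2]; field_simp
  have hrisk : ∀ θ : EuclideanSpace ℝ (Fin d), ‖θ‖ ≤ c →
      ∫⁻ w, ENNReal.ofReal (‖T (θ + (σ / √(d : ℝ)) • w) - θ‖ ^ 2)
        ∂(stdGaussian (EuclideanSpace ℝ (Fin d))) ≤ maxRisk Q c T := by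
    intro θ hθ
    have hmem := hQ θ hθ
    have e : σ ^ 2 / (d : ℝ) = (σ / √(d : ℝ)) ^ 2 := by rw [div_pow, hs2]
    rw [e, multivariateGaussian_smul_one θ (by positivity)] at hmem
    calc _ = risk ((stdGaussian (EuclideanSpace ℝ (Fin d))).map
          (fun x => θ + (σ / √(d : ℝ)) • x)) θ T := by
          rw [risk, lintegral_map (by fun_prop) (by fun_prop)]
      _ ≤ ⨆ (P : Measure (EuclideanSpace ℝ (Fin d))) (_ : P ∈ Q θ), risk P θ T :=
          le_iSup₂ (f := fun P (_ : P ∈ Q θ) => risk P θ T) _ hmem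
      _ ≤ _ := le_iSup₂ (f := fun θ (_ : ‖θ‖ ≤ c) => ⨆ P ∈ Q θ, risk P θ T) θ hθ
  -- Coordinate variance b²/d gives the prior mean squared norm b² < c²; the truncation error is
  -- then of order (b⁴/d²)·d.
  have key := bayesRisk_le_add (d := d) (b := b / √(d : ℝ)) (s := σ / √(d : ℝ)) (c := c)
    (hb.trans hbc) (by positivity) (by rw [hb2]; linarith) hT hrisk
  rw [hb2] at key
  have hsum : 0 < σ ^ 2 + b ^ 2 := by positivity
  have e1 : (b / √(d : ℝ)) ^ 2 * (σ / √(d : ℝ)) ^ 2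
      / ((b / √(d : ℝ)) ^ 2 + (σ / √(d : ℝ)) ^ 2) * d = σ ^ 2 * b ^ 2 / (σ ^ 2 + b ^ 2) := by
    simp only [div_pow, hs2]
    field_simp
    ring
  have e2 : 4 * (1 + b ^ 2 / (c ^ 2 - b ^ 2)) / (c ^ 2 - b ^ 2) * (b / √(d : ℝ)) ^ 4
      * (d * Var[fun x => x ^ 2; gaussianReal 0 1])
      = 4 * (1 + b ^ 2 / (c ^ 2 - b ^ 2)) / (c ^ 2 - b ^ 2) * b ^ 4
        * Var[fun x => x ^ 2; gaussianReal 0 1] / d := by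
    rw [div_pow, show √(d : ℝ) ^ 4 = (√(d : ℝ) ^ 2) ^ 2 by ring, hs2]
    field_simp
  rw [e1, e2] at key
  rw [ENNReal.ofReal_sub _ (div_nonneg
    (mul_nonneg (by positivity) (variance_nonneg _ _)) hd0.le)]
  exact tsub_le_iff_right.2 key

/-! ### Asymptotic adaptivity -/

/-- The maximal risk of the James–Stein estimator over the standardized class. -/
lemma exists_maxRisk_shrinkage_le {σ C₄ K c : ℝ} (hσ : 0 < σ) (hC : 0 < C₄) (hK : 0 < K)
    (hc : 0 < c) :
    ∃ A : ℝ, ∀ d : ℕ, 3 ≤ d →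
      maxRisk (mixtureClass d (σ ^ 2 / d) (C₄ / (d : ℝ) ^ 2) (K * (d : ℝ) ^ 2)) c
          (shrinkage (((d : ℝ) - 2) * (σ ^ 2 / d)))
        ≤ ENNReal.ofReal (σ ^ 2 * c ^ 2 / (σ ^ 2 + c ^ 2) + A / d) := by
  refine ⟨4 * σ ^ 2 + 2 * σ ^ 2 * (K * ((C₄ + 5 * σ ^ 4)
    + c * (3 / 2 * (σ ^ 2 + C₄) + 5 * (σ ^ 2 + σ ^ 4)))), fun d hd => ?_⟩
  refine iSup₂_le fun θ hθ => iSup₂_le fun P hP => ?_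
  have hd3 : (3 : ℝ) ≤ d := by exact_mod_cast hd
  have hd0 : (0 : ℝ) < d := by linarith
  have hs : 0 < √(d : ℝ) := Real.sqrt_pos.2 hd0
  have hs2 : (d : ℝ) = √(d : ℝ) ^ 2 := (Real.sq_sqrt hd0.le).symm
  -- The scale s = 1/√d is that of a coordinate of Y; with ‖θ‖₁ ≤ √d c it makes every error term
  -- O(1/d).
  refine (risk_shrinkage_le hσ (by positivity) (by positivity) hd hP
    (s := 1 / √(d : ℝ)) (by positivity)).trans (ENNReal.ofReal_le_ofReal ?_)
  have hl1 : ∑ i, |θ i| ≤ √(d : ℝ) * c := by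
    have h1 := Finset.sum_mul_sq_le_sq_mul_sq Finset.univ (fun _ : Fin d => (1 : ℝ))
      (fun i => |θ i|)
    simp only [one_mul, one_pow, sq_abs, Finset.sum_const, Finset.card_univ, Fintype.card_fin,
      nsmul_eq_mul, mul_one] at h1
    rw [← EuclideanSpace.real_norm_sq_eq] at h1
    refine le_of_sq_le_sq ?_ (by positivity)
    calc (∑ i, |θ i|) ^ 2 ≤ d * ‖θ‖ ^ 2 := h1
      _ ≤ d * c ^ 2 := by gcongr
      _ = (√(d : ℝ) * c) ^ 2 := by rw [mul_pow, ← hs2]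
  have hfirst : σ ^ 2 / (σ ^ 2 + ‖θ‖ ^ 2) * (‖θ‖ ^ 2 + 4 * σ ^ 2 / d)
      ≤ σ ^ 2 * c ^ 2 / (σ ^ 2 + c ^ 2) + 4 * σ ^ 2 / d := by
    have hθ2 : ‖θ‖ ^ 2 ≤ c ^ 2 := by gcongr
    have h1 : σ ^ 2 / (σ ^ 2 + ‖θ‖ ^ 2) * ‖θ‖ ^ 2 ≤ σ ^ 2 * c ^ 2 / (σ ^ 2 + c ^ 2) := by
      rw [div_mul_eq_mul_div, div_le_div_iff₀ (by positivity) (by positivity)]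
      nlinarith [mul_le_mul_of_nonneg_left hθ2 (by positivity : 0 ≤ σ ^ 4)]
    have h2 : σ ^ 2 / (σ ^ 2 + ‖θ‖ ^ 2) * (4 * σ ^ 2 / d) ≤ 1 * (4 * σ ^ 2 / d) := by
      gcongr
      exact (div_le_one (by positivity)).2 (by nlinarith [sq_nonneg ‖θ‖])
    rw [mul_add]
    linarith
  have hlam : 2 * (((d : ℝ) - 2) * (σ ^ 2 / d)) ≤ 2 * σ ^ 2 := by
    have : ((d : ℝ) - 2) * (σ ^ 2 / d) ≤ d * (σ ^ 2 / d) := by gcongr; linarith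
    rw [mul_div_cancel₀ _ hd0.ne'] at this
    linarith
  have hB : √(d : ℝ) * c * (3 / 2 * (1 / √(d : ℝ) * (σ ^ 2 / d) + C₄ / (d : ℝ) ^ 2 / (1 / √(d : ℝ)))
      + 5 * (σ ^ 2 / d) * (1 / √(d : ℝ) + σ ^ 2 / d / (1 / √(d : ℝ))))
      = c * (3 / 2 * (σ ^ 2 + C₄) + 5 * (σ ^ 2 + σ ^ 4)) / d := by
    generalize √(d : ℝ) = r at *
    rw [hs2]
    field_simp
  have hsecond : 2 * (((d : ℝ) - 2) * (σ ^ 2 / d)) * ((d * (C₄ / (d : ℝ) ^ 2 + 5 * (σ ^ 2 / d) ^ 2)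
      + (∑ i, |θ i|) * (3 / 2 * (1 / √(d : ℝ) * (σ ^ 2 / d) + C₄ / (d : ℝ) ^ 2 / (1 / √(d : ℝ)))
        + 5 * (σ ^ 2 / d) * (1 / √(d : ℝ) + σ ^ 2 / d / (1 / √(d : ℝ)))))
          * (K * (d : ℝ) ^ 2 / (d : ℝ) ^ 2))
      ≤ 2 * σ ^ 2 * (K * ((C₄ + 5 * σ ^ 4)
        + c * (3 / 2 * (σ ^ 2 + C₄) + 5 * (σ ^ 2 + σ ^ 4)))) / d := by
    have hn : 0 ≤ ∑ i, |θ i| := Finset.sum_nonneg fun i _ => abs_nonneg _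
    calc _ ≤ 2 * σ ^ 2 * ((d * (C₄ / (d : ℝ) ^ 2 + 5 * (σ ^ 2 / d) ^ 2)
        + √(d : ℝ) * c *
          (3 / 2 * (1 / √(d : ℝ) * (σ ^ 2 / d) + C₄ / (d : ℝ) ^ 2 / (1 / √(d : ℝ)))
            + 5 * (σ ^ 2 / d) * (1 / √(d : ℝ) + σ ^ 2 / d / (1 / √(d : ℝ)))))
          * (K * (d : ℝ) ^ 2 / (d : ℝ) ^ 2)) := by gcongr
      _ = _ := by
        rw [hB]
        field_simp
  calc _ ≤ _ := add_le_add hfirst hsecond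
    _ = _ := by ring

lemma tendsto_ofReal_add_div (x A : ℝ) :
    Tendsto (fun d : ℕ => ENNReal.ofReal (x + A / d)) atTop (𝓝 (ENNReal.ofReal x)) := by
  refine ENNReal.tendsto_ofReal ?_
  simpa using tendsto_const_nhds.add (tendsto_const_div_atTop_nhds_zero_nat A)

/-- The minimax risk lies below the maximal risk of `shrinkage`, so a lower bound for the former and
an upper bound for the latter give both limits. -/
lemma tendsto_minimaxRisk_and_maxRisk {σ C₄ Cneg c : ℝ} (hσ : 0 < σ) (hC : 0 < C₄)
    (hK : 0 < Cneg) (hc : 0 < c)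
    (hgauss : ∀ᶠ d : ℕ in atTop, ∀ θ : EuclideanSpace ℝ (Fin d), ‖θ‖ ≤ c →
      multivariateGaussian θ ((σ ^ 2 / (d : ℝ)) • (1 : Matrix (Fin d) (Fin d) ℝ)) ∈
        mixtureClass d (σ ^ 2 / d) (C₄ / (d : ℝ) ^ 2) (Cneg * (d : ℝ) ^ 2) θ) :
    Tendsto (fun d : ℕ => minimaxRisk
        (mixtureClass d (σ ^ 2 / d) (C₄ / (d : ℝ) ^ 2) (Cneg * (d : ℝ) ^ 2)) c)
      atTop (𝓝 (ENNReal.ofReal (σ ^ 2 * c ^ 2 / (σ ^ 2 + c ^ 2)))) ∧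
    Tendsto (fun d : ℕ => maxRisk
        (mixtureClass d (σ ^ 2 / d) (C₄ / (d : ℝ) ^ 2) (Cneg * (d : ℝ) ^ 2)) c
        (shrinkage (((d : ℝ) - 2) * (σ ^ 2 / d))))
      atTop (𝓝 (ENNReal.ofReal (σ ^ 2 * c ^ 2 / (σ ^ 2 + c ^ 2)))) := by
  have hle : ∀ d : ℕ, minimaxRisk
      (mixtureClass d (σ ^ 2 / d) (C₄ / (d : ℝ) ^ 2) (Cneg * (d : ℝ) ^ 2)) c ≤ maxRisk
        (mixtureClass d (σ ^ 2 / d) (C₄ / (d : ℝ) ^ 2) (Cneg * (d : ℝ) ^ 2)) c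
        (shrinkage (((d : ℝ) - 2) * (σ ^ 2 / d))) :=
    fun d => iInf₂_le _ (measurable_shrinkage _)
  have hlower : ∀ a < ENNReal.ofReal (σ ^ 2 * c ^ 2 / (σ ^ 2 + c ^ 2)), ∀ᶠ d : ℕ in atTop,
      a < minimaxRisk
        (mixtureClass d (σ ^ 2 / d) (C₄ / (d : ℝ) ^ 2) (Cneg * (d : ℝ) ^ 2)) c := by
    intro a ha
    have hcont : ContinuousAt
        (fun b : ℝ => ENNReal.ofReal (σ ^ 2 * b ^ 2 / (σ ^ 2 + b ^ 2))) c := by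
      refine ENNReal.continuous_ofReal.continuousAt.comp ?_
      have : ∀ b : ℝ, σ ^ 2 + b ^ 2 ≠ 0 := fun b => by positivity
      fun_prop (disch := exact this _)
    -- The radius b is fixed before d grows, since the constant `A` of the lower bound depends on b
    -- and contains 1/(c²-b²).
    have hev : ∀ᶠ b in 𝓝[<] c, a < ENNReal.ofReal (σ ^ 2 * b ^ 2 / (σ ^ 2 + b ^ 2)) :=
      (hcont.eventually (lt_mem_nhds ha)).filter_mono nhdsWithin_le_nhds
    obtain ⟨b, hab, hb0, hbc⟩ := (hev.and (Ioo_mem_nhdsLT hc)).exists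
    obtain ⟨A, -, hA⟩ := exists_le_minimaxRisk hσ hb0 hbc
    have ht := tendsto_ofReal_add_div (σ ^ 2 * b ^ 2 / (σ ^ 2 + b ^ 2)) (-A)
    filter_upwards [hgauss, ht.eventually (lt_mem_nhds hab), eventually_gt_atTop 0]
      with d h1 h2 h3
    refine h2.trans_le (le_trans (le_of_eq ?_) (hA d h3 _ h1))
    rw [neg_div, ← sub_eq_add_neg]
  have hupper : ∀ a > ENNReal.ofReal (σ ^ 2 * c ^ 2 / (σ ^ 2 + c ^ 2)), ∀ᶠ d : ℕ in atTop,
      maxRisk (mixtureClass d (σ ^ 2 / d) (C₄ / (d : ℝ) ^ 2) (Cneg * (d : ℝ) ^ 2)) c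
        (shrinkage (((d : ℝ) - 2) * (σ ^ 2 / d))) < a := by
    intro a ha
    obtain ⟨A, hA⟩ := exists_maxRisk_shrinkage_le hσ hC hK hc
    filter_upwards [(tendsto_ofReal_add_div _ A).eventually (gt_mem_nhds ha),
      eventually_ge_atTop 3] with d h1 h2
    exact (hA d h2).trans_lt h1
  exact ⟨tendsto_order.2 ⟨hlower, fun a ha => (hupper a ha).mono fun d h => (hle d).trans_lt h⟩,
    tendsto_order.2 ⟨fun a ha => (hlower a ha).mono fun d h => h.trans_le (hle d), hupper⟩⟩

end JamesSteinZeroBias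

theorem theorem4p6 :
    -- the explicit risk bound
    (∀ σ C₄ Cneg : ℝ, 0 < σ → 0 < C₄ → 0 < Cneg →
      ∃ L : ℝ, 0 < L ∧ ∀ d : ℕ, 3 ≤ d → ∀ θ : EuclideanSpace ℝ (Fin d),
        ∀ P ∈ JamesSteinZeroBias.mixtureClass d (σ ^ 2 / d) C₄ Cneg θ,
          JamesSteinZeroBias.risk P θ
              (JamesSteinZeroBias.shrinkage (((d : ℝ) - 2) * (σ ^ 2 / d)))
            ≤ ENNReal.ofReal
              (σ ^ 2 / (σ ^ 2 + ‖θ‖ ^ 2) * (‖θ‖ ^ 2 + 4 * σ ^ 2 / d)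
                + L * (((d : ℝ) - 2) * (σ ^ 2 / d))
                  * (1 / d + (∑ i, |θ i|) / (d : ℝ) ^ 2 + ‖θ‖ ^ 2 / (d : ℝ) ^ 3))) ∧
    -- asymptotic adaptivity of the James-Stein estimator
    (∀ σ C₄ Cneg c : ℝ, 0 < σ → 0 < C₄ → 0 < Cneg → 0 < c →
      (∀ᶠ d : ℕ in atTop, ∀ θ : EuclideanSpace ℝ (Fin d), ‖θ‖ ≤ c →
        multivariateGaussian θ ((σ ^ 2 / (d : ℝ)) • (1 : Matrix (Fin d) (Fin d) ℝ)) ∈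
          JamesSteinZeroBias.mixtureClass d (σ ^ 2 / d)
            (C₄ / (d : ℝ) ^ 2) (Cneg * (d : ℝ) ^ 2) θ) →
      Tendsto (fun d : ℕ => JamesSteinZeroBias.minimaxRisk
          (JamesSteinZeroBias.mixtureClass d (σ ^ 2 / d)
            (C₄ / (d : ℝ) ^ 2) (Cneg * (d : ℝ) ^ 2)) c)
        atTop (𝓝 (ENNReal.ofReal (σ ^ 2 * c ^ 2 / (σ ^ 2 + c ^ 2)))) ∧
      Tendsto (fun d : ℕ => JamesSteinZeroBias.maxRisk
          (JamesSteinZeroBias.mixtureClass d (σ ^ 2 / d)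
            (C₄ / (d : ℝ) ^ 2) (Cneg * (d : ℝ) ^ 2)) c
          (JamesSteinZeroBias.shrinkage (((d : ℝ) - 2) * (σ ^ 2 / d))))
        atTop (𝓝 (ENNReal.ofReal (σ ^ 2 * c ^ 2 / (σ ^ 2 + c ^ 2))))) := by
  exact ⟨fun _ _ _ hσ hC hK => JamesSteinZeroBias.exists_risk_shrinkage_le hσ hC hK,
    fun _ _ _ _ hσ hC hK hc h =>
      JamesSteinZeroBias.tendsto_minimaxRisk_and_maxRisk hσ hC hK hc h⟩
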